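/- Let $H$ be a complex separable Hilbert space and let $A,B,X\in\mathbb B(H)$ with $A,B$ positive. Let $|||\cdot|||$ be a unitarily invariant norm, defined on a two-sided ideal $\mathfrak J$ of $\mathbb B(H)$ (so $|||UYV|||=|||Y|||$ for $Y\in\mathfrak J$ and unitaries $U,V$; completeness of $\mathfrak J$ is not needed). For $\nu\in[0,1]$ put $$T(\nu)=A^{\nu}XB^{1-\nu}+A^{1-\nu}XB^{\nu},\qquad F(\nu)=|||T(\nu)|||,$$ and for $a\le b$ and $n\in\mathbb N_0$ put $$x_n(F,a,b)=\frac1{2^n}\sum_{i=1}^{2^n}F\Big(a+\big(i-\tfrac12\big)\frac{b-a}{2^n}\Big),$$ $$y_n(F,a,b)=\frac1{2^n}\Big(\frac{F(a)+F(b)}2+\sum_{i=1}^{2^n-1}F\Big(\big(1-\tfrac i{2^n}\big)a+\tfrac i{2^n}b\Big)\Big),$$ $$m_F(a,b)=\frac1{b-a}\int_a^bF(x)\,dx\ \ (a<b),\qquad m_F(a,a)=F(a).$$ Let $\mu\in[0,1]$. Assume that $X\in\mathfrak J$; or, alternatively, that $T(\nu)\in\mathfrak J$ for all $\nu$ between $\mu$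 and $1-\mu$ and that $|||\cdot|||$ respects Ky Fan dominance (if $Y,Z\in\mathfrak J$ and every Ky Fan norm of $Y$, i.e. the sum of its $k$ largest singular values, is at most that of $Z$, then $|||Y|||\le|||Z|||$). 1. If $\mu\in[0,1/2]$, then $F$ is integrable on $[\mu,1-\mu]$ and, for every $n$, $$2|||A^{1/2}XB^{1/2}|||=x_0(F,\mu,1-\mu)\le\cdots\le x_n(F,\mu,1-\mu)\le m_F(\mu,1-\mu)\le y_n(F,\mu,1-\mu)\le\cdots\le y_0(F,\mu,1-\mu)=F(\mu).$$ Moreover $x_n(F,\mu,1-\mu)$ and $y_n(F,\mu,1-\mu)$ both converge to $m_F(\mu,1-\mu)$ as $n\to\infty$. 2. If $\mu\in[1/2,1]$, the same statements hold with $[\mu,1-\mu]$ and $(F,\mu,1-\mu)$ replaced by $[1-\mu,\mu]$ and $(F,1-\mu,\mu)$; in particular $$2|||A^{1/2}XB^{1/2}|||=x_0(F,1-\mu,\mu)\le\cdots\le x_n(F,1-\mu,\mu)\le m_F(1-\mu,\mu)\le y_n(F,1-\mu,\mu)\le\cdots\le y_0(F,1-\mu,\mu)=F(\mu).$$ -/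

import Mathlib

/-- A unitarily invariant norm on a norm ideal of `𝔹(H)`: a two-sided ideal `ideal` of bounded
operators together with a norm `|||·|||` on it such that `|||U X V||| = |||X|||` for all unitaries
`U`, `V` and all `X` in the ideal.  The function `val` is defined on all operators for convenience;
only its values on the ideal are constrained.  Completeness of the ideal is not required. -/
structure UnitarilyInvariantNorm (H : Type*) [NormedAddCommGroup H] [InnerProductSpace ℂ H]
    [CompleteSpace H] where
  /-- the norm ideal on which the norm is defined -/
  ideal : Submodule ℂ (H →L[ℂ] H)
  mul_mem_left : ∀ S X : H →L[ℂ] H, X ∈ ideal → S * X ∈ ideal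
  mul_mem_right : ∀ S X : H →L[ℂ] H, X ∈ ideal → X * S ∈ ideal
  /-- the norm `|||·|||` -/
  val : (H →L[ℂ] H) → ℝ
  val_add_le : ∀ X ∈ ideal, ∀ Y ∈ ideal, val (X + Y) ≤ val X + val Y
  val_smul : ∀ (c : ℂ), ∀ X ∈ ideal, val (c • X) = ‖c‖ * val X
  eq_zero_of_val_eq_zero : ∀ X ∈ ideal, val X = 0 → X = 0
  val_unitary_mul_mul : ∀ U ∈ unitary (H →L[ℂ] H), ∀ V ∈ unitary (H →L[ℂ] H), ∀ X ∈ ideal,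
    val (U * X * V) = val X

/-- The `k`-th Ky Fan norm of a bounded operator, i.e. the sum of its `k` largest singular values,
written as the supremum of `∑ i < j, |⟨f i, X (e i)⟩|` over all `j ≤ k` and all orthonormal families
`e`, `f` of length `j` (lengths `j < k` matter only if `dim H < k`). -/
noncomputable def kyFanNorm {H : Type*} [NormedAddCommGroup H] [InnerProductSpace ℂ H]
    (k : ℕ) (X : H →L[ℂ] H) : ℝ :=
  sSup {r : ℝ | ∃ j : ℕ, j ≤ k ∧ ∃ e f : Fin j → H, Orthonormal ℂ e ∧ Orthonormal ℂ f ∧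
    r = ∑ i, ‖inner ℂ (f i) (X (e i))‖}

/-- Ky Fan dominance: on its ideal, the norm is monotone with respect to the simultaneous order of
all Ky Fan norms. -/
def UnitarilyInvariantNorm.KyFanDominance {H : Type*} [NormedAddCommGroup H]
    [InnerProductSpace ℂ H] [CompleteSpace H] (N : UnitarilyInvariantNorm H) : Prop :=
  ∀ X ∈ N.ideal, ∀ Y ∈ N.ideal, (∀ k : ℕ, kyFanNorm k X ≤ kyFanNorm k Y) → N.val X ≤ N.val Y

/-- The operator `A^ν X B^(1-ν) + A^(1-ν) X B^ν`; the powers of the positive operators `A`, `B` are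
those of the continuous functional calculus, with `A^0 = 1`. -/
noncomputable def heinzSum {H : Type*} [NormedAddCommGroup H] [InnerProductSpace ℂ H]
    [CompleteSpace H] (A B X : H →L[ℂ] H) (ν : ℝ) : H →L[ℂ] H :=
  A ^ ν * X * B ^ (1 - ν) + A ^ (1 - ν) * X * B ^ ν

/-- The function `F(ν) = |||A^ν X B^(1-ν) + A^(1-ν) X B^ν|||`. -/
noncomputable def heinzNorm {H : Type*} [NormedAddCommGroup H] [InnerProductSpace ℂ H]
    [CompleteSpace H] (N : UnitarilyInvariantNorm H) (A B X : H →L[ℂ] H) (ν : ℝ) : ℝ :=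
  N.val (heinzSum A B X ν)

/-- `x_n(F,a,b) = 2^(-n) ∑_{i=1}^{2^n} F(a + (i - 1/2)(b-a)/2^n)`. -/
noncomputable def dyadicMidpoint (F : ℝ → ℝ) (a b : ℝ) (n : ℕ) : ℝ :=
  1 / 2 ^ n * ∑ i ∈ Finset.Icc (1 : ℕ) (2 ^ n), F (a + ((i : ℝ) - 1 / 2) * ((b - a) / 2 ^ n))

/-- `y_n(F,a,b) = 2^(-n) ((F(a)+F(b))/2 + ∑_{i=1}^{2^n-1} F((1 - i/2^n) a + (i/2^n) b))`. -/
noncomputable def dyadicTrapezoid (F : ℝ → ℝ) (a b : ℝ) (n : ℕ) : ℝ :=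
  1 / 2 ^ n * ((F a + F b) / 2 +
    ∑ i ∈ Finset.Icc (1 : ℕ) (2 ^ n - 1), F ((1 - (i : ℝ) / 2 ^ n) * a + (i : ℝ) / 2 ^ n * b))

/-- The mean `(1/(b-a)) ∫_a^b F(x) dx`, read as its limiting value `F(a)` when `a = b`. -/
noncomputable def integralMean (F : ℝ → ℝ) (a b : ℝ) : ℝ :=
  if a = b then F a else 1 / (b - a) * ∫ x in a..b, F x

/-! Everything follows from convexity of `F` together with the symmetry `F (1 - ν) = F ν`. For a
convex function the dyadic inequalities and limits are Hermite–Hadamard on repeatedly halved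
intervals (`ConvexOn.dyadic_bounds`, `ConvexOn.tendsto_dyadicTrapezoid`); symmetry identifies the
two ends of the chain.

Midpoint convexity of `F` is the arithmetic–geometric mean inequality `2|||PZQ||| ≤ |||P²Z + ZQ²|||`
with `P = A^d`, `Q = B^d` (`two_mul_heinzNorm_le`), and an upper bound upgrades it to convexity. The
mean inequality is obtained on the ideal as a normed space, without completeness. With `P = e^h`, `Q
= e^k`, the group `Φ z Y = e^(zh) Y e^(-zk)` is isometric for imaginary `z`, so its generator `δ`
satisfies `‖(δ - z)Y‖ ≥ ‖z‖‖Y‖` there. The polynomial `(1 + x/n)^n + (1 - x/n)^n` has only imaginary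
roots and value `2` at `0`, hence is bounded below by `2` at `δ`; letting `n → ∞` gives `2‖Y‖ ≤ ‖Φ 1
Y + Φ (-1) Y‖`.

If only the `T(ν)` lie in the ideal, the inequalities are proved for Ky Fan norms, which are defined
on all operators, and carried over by dominance. -/

/-! ### Convex functions: Hermite–Hadamard and its dyadic refinements. -/

section HermiteHadamard

open MeasureTheory Set

/-- A midpoint convex function on a compact interval which is bounded above is convex. -/
theorem convexOn_Icc_of_midpoint {F : ℝ → ℝ} {a b M : ℝ} (hM : ∀ x ∈ Icc a b, F x ≤ M)
    (hF : ∀ x ∈ Icc a b, ∀ y ∈ Icc a b, F ((x + y) / 2) ≤ (F x + F y) / 2) :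
    ConvexOn ℝ (Icc a b) F := by
  refine ⟨convex_Icc a b, ?_⟩
  intro x hx y hy s t hs ht hst
  set g : ℝ → ℝ := fun t => F ((1 - t) * x + t * y) - ((1 - t) * F x + t * F y) with hg
  have hmem : ∀ t ∈ Icc (0 : ℝ) 1, (1 - t) * x + t * y ∈ Icc a b := by
    intro t ht
    have := (convex_Icc a b) hx hy (sub_nonneg.2 ht.2) ht.1 (by ring)
    simpa using this
  have hg0 : g 0 = 0 := by simp [hg]
  have hg1 : g 1 = 0 := by simp [hg]
  have hmid : ∀ t ∈ Icc (0 : ℝ) 1, ∀ u ∈ Icc (0 : ℝ) 1, g ((t + u) / 2) ≤ (g t + g u) / 2 := by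
    intro t ht u hu
    have := hF _ (hmem t ht) _ (hmem u hu)
    have e : ((1 - t) * x + t * y + ((1 - u) * x + u * y)) / 2
      = (1 - (t + u) / 2) * x + (t + u) / 2 * y := by ring
    rw [e] at this
    simp only [hg]
    linarith
  have hbdd : BddAbove (g '' Icc 0 1) := by
    refine ⟨M + |F x| + |F y|, ?_⟩
    rintro _ ⟨t, ht, rfl⟩
    have h1 := hM _ (hmem t ht)
    have h2 : -((1 - t) * F x) ≤ |F x| := by
      rw [← mul_neg]
      calc (1 - t) * -F x ≤ (1 - t) * |F x| :=
            mul_le_mul_of_nonneg_left (neg_le_abs _) (sub_nonneg.2 ht.2)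
        _ ≤ |F x| := mul_le_of_le_one_left (abs_nonneg _) (by linarith [ht.1])
    have h3 : -(t * F y) ≤ |F y| := by
      rw [← mul_neg]
      calc t * -F y ≤ t * |F y| := mul_le_mul_of_nonneg_left (neg_le_abs _) ht.1
        _ ≤ |F y| := mul_le_of_le_one_left (abs_nonneg _) ht.2
    simp only [hg]
    linarith
  set S := sSup (g '' Icc 0 1)
  have hle : ∀ t ∈ Icc (0 : ℝ) 1, g t ≤ S := fun t ht => le_csSup hbdd ⟨t, ht, rfl⟩
  -- `g` is `F` minus its chord, so it vanishes at `0` and `1`. Each `t` is the midpoint of an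
  -- endpoint and a second point of `[0, 1]`, whence `g t ≤ S / 2` and finally `S ≤ 0`.
  have hhalf : S ≤ S / 2 := by
    refine csSup_le ⟨_, 0, by simp, rfl⟩ ?_
    rintro _ ⟨t, ht, rfl⟩
    rcases le_total t (1 / 2) with h | h
    · have h2 : 2 * t ∈ Icc (0 : ℝ) 1 := ⟨by linarith [ht.1], by linarith⟩
      have := hmid 0 (by simp) (2 * t) h2
      rw [show (0 + 2 * t) / 2 = t by ring, hg0] at this
      linarith [hle _ h2]
    · have h2 : 2 * t - 1 ∈ Icc (0 : ℝ) 1 := ⟨by linarith, by linarith [ht.2]⟩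
      have := hmid 1 (by simp) (2 * t - 1) h2
      rw [show (1 + (2 * t - 1)) / 2 = t by ring, hg1] at this
      linarith [hle _ h2]
  have := hle t ⟨ht, by linarith⟩
  simp only [hg] at this
  rw [show s = 1 - t by linarith]
  simp only [smul_eq_mul]
  linarith

theorem ConvexOn.map_midpoint_le {F : ℝ → ℝ} {s : Set ℝ} (hF : ConvexOn ℝ s F) {x y : ℝ}
    (hx : x ∈ s) (hy : y ∈ s) : F ((x + y) / 2) ≤ (F x + F y) / 2 := by
  have := hF.2 hx hy (show (0 : ℝ) ≤ 1 / 2 by norm_num) (show (0 : ℝ) ≤ 1 / 2 by norm_num)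
    (by norm_num)
  simp only [smul_eq_mul] at this
  rw [show (x + y) / 2 = 1 / 2 * x + 1 / 2 * y by ring]
  linarith

/-- The sum of the values of a convex function at two points symmetric about the centre of an
interval is at most the sum of its values at the end points. -/
theorem ConvexOn.add_reflect_le {F : ℝ → ℝ} {a b : ℝ} (hF : ConvexOn ℝ (Icc a b) F) {x : ℝ}
    (hx : x ∈ Icc a b) : F x + F (a + b - x) ≤ F a + F b := by
  have hab : a ≤ b := hx.1.trans hx.2
  rcases hab.eq_or_lt with rfl | hlt
  · obtain rfl : x = a := le_antisymm hx.2 hx.1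
    simp
  have hd : 0 < b - a := sub_pos.2 hlt
  have ha : a ∈ Icc a b := left_mem_Icc.2 hab
  have hb : b ∈ Icc a b := right_mem_Icc.2 hab
  have hs : 0 ≤ (b - x) / (b - a) := div_nonneg (by linarith [hx.2]) hd.le
  have ht : 0 ≤ (x - a) / (b - a) := div_nonneg (by linarith [hx.1]) hd.le
  have hst : (b - x) / (b - a) + (x - a) / (b - a) = 1 := by field_simp; ring
  have h1 := hF.2 ha hb hs ht hst
  have h2 := hF.2 ha hb ht hs (by linarith)
  simp only [smul_eq_mul] at h1 h2
  rw [show (b - x) / (b - a) * a + (x - a) / (b - a) * b = x by field_simp; ring] at h1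
  rw [show (x - a) / (b - a) * a + (b - x) / (b - a) * b = a + b - x by field_simp; ring] at h2
  have : (b - x) / (b - a) * F a + (x - a) / (b - a) * F b
      + ((x - a) / (b - a) * F a + (b - x) / (b - a) * F b)
      = ((b - x) / (b - a) + (x - a) / (b - a)) * (F a + F b) := by ring
  rw [hst] at this
  linarith

theorem ConvexOn.intervalIntegrable_Icc {F : ℝ → ℝ} {a b : ℝ} (hab : a ≤ b)
    (hF : ConvexOn ℝ (Icc a b) F) : IntervalIntegrable F volume a b := by
  rw [intervalIntegrable_iff_integrableOn_Ioo_of_le hab]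
  have hc : ContinuousOn F (Ioo a b) :=
    (hF.subset Ioo_subset_Icc_self (convex_Ioo a b)).continuousOn isOpen_Ioo
  have hub : ∀ x ∈ Icc a b, F x ≤ max (F a) (F b) := fun x hx =>
    hF.le_max_of_mem_Icc (left_mem_Icc.2 hab) (right_mem_Icc.2 hab) hx
  -- The lower bound comes from reflection in the centre: `F x ≥ 2 F((a+b)/2) - F(a+b-x)`, where the
  -- last value is at most the maximum over the end points.
  refine IntegrableOn.of_bound (C := |max (F a) (F b)| + |2 * F ((a + b) / 2)|) (by simp)
    (hc.aestronglyMeasurable measurableSet_Ioo) ?_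
  refine (ae_restrict_iff' measurableSet_Ioo).2 (Filter.Eventually.of_forall fun x hx => ?_)
  have hx' : x ∈ Icc a b := Ioo_subset_Icc_self hx
  have hy' : a + b - x ∈ Icc a b := ⟨by linarith [hx.2], by linarith [hx.1]⟩
  have h1 := hF.map_midpoint_le hx' hy'
  rw [show (x + (a + b - x)) / 2 = (a + b) / 2 by ring] at h1
  have h2 := hub _ hx'
  have h3 := hub _ hy'
  rw [Real.norm_eq_abs, abs_le]
  have h4 := le_abs_self (max (F a) (F b))
  have h5 := neg_abs_le (2 * F ((a + b) / 2))
  have h6 := abs_nonneg (2 * F ((a + b) / 2))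
  constructor <;> linarith

/-- The Hermite–Hadamard inequality. -/
theorem ConvexOn.hermite_hadamard {F : ℝ → ℝ} {a b : ℝ} (hab : a ≤ b)
    (hF : ConvexOn ℝ (Icc a b) F) :
    F ((a + b) / 2) ≤ integralMean F a b ∧ integralMean F a b ≤ (F a + F b) / 2 := by
  unfold integralMean
  split_ifs with h
  · subst h
    simp
  have hlt : a < b := lt_of_le_of_ne hab h
  have hd : 0 < b - a := sub_pos.2 hlt
  have hi := hF.intervalIntegrable_Icc hab
  have hi' : IntervalIntegrable (fun x => F (a + b - x)) volume a b := by
    have := hi.symm.comp_sub_left (a + b)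
    simpa using this
  -- The symmetrised integrand lies pointwise between `2 F((a+b)/2)` and `F a + F b`.
  have hsum : ∫ x in a..b, (F x + F (a + b - x)) = 2 * ∫ x in a..b, F x := by
    rw [intervalIntegral.integral_add hi hi', intervalIntegral.integral_comp_sub_left]
    simp only [add_sub_cancel_left, add_sub_cancel_right]
    ring
  have hlo : ∫ x in a..b, 2 * F ((a + b) / 2) ≤ ∫ x in a..b, (F x + F (a + b - x)) := by
    refine intervalIntegral.integral_mono_on hab (by simp) (hi.add hi') fun x hx => ?_
    have hy' : a + b - x ∈ Icc a b := ⟨by linarith [hx.2], by linarith [hx.1]⟩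
    have h1 := hF.map_midpoint_le hx hy'
    rw [show (x + (a + b - x)) / 2 = (a + b) / 2 by ring] at h1
    linarith
  have hhi : ∫ x in a..b, (F x + F (a + b - x)) ≤ ∫ x in a..b, (F a + F b) :=
    intervalIntegral.integral_mono_on hab (hi.add hi') (by simp) fun x hx => hF.add_reflect_le hx
  rw [hsum, intervalIntegral.integral_const, smul_eq_mul] at hlo hhi
  rw [one_div, inv_mul_eq_div]
  constructor
  · rw [le_div_iff₀ hd]; linarith
  · rw [div_le_iff₀ hd]; linarith

theorem dyadicMidpoint_zero (F : ℝ → ℝ) (a b : ℝ) :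
    dyadicMidpoint F a b 0 = F ((a + b) / 2) := by
  simp only [dyadicMidpoint, pow_zero, Finset.Icc_self, Finset.sum_singleton]
  norm_num
  congr 1
  ring

theorem dyadicTrapezoid_zero (F : ℝ → ℝ) (a b : ℝ) :
    dyadicTrapezoid F a b 0 = (F a + F b) / 2 := by
  simp [dyadicTrapezoid]

theorem sum_Icc_one_add (f : ℕ → ℝ) (p q : ℕ) :
    ∑ i ∈ Finset.Icc 1 (p + q), f i
      = ∑ i ∈ Finset.Icc 1 p, f i + ∑ i ∈ Finset.Icc 1 q, f (p + i) := by
  induction q with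
  | zero => simp
  | succ q ih =>
    rw [← add_assoc, Finset.sum_Icc_succ_top (by omega), ih, Finset.sum_Icc_succ_top (by omega)]
    ring_nf

theorem dyadicMidpoint_succ (F : ℝ → ℝ) (a b : ℝ) (n : ℕ) :
    dyadicMidpoint F a b (n + 1)
      = (dyadicMidpoint F a ((a + b) / 2) n + dyadicMidpoint F ((a + b) / 2) b n) / 2 := by
  have h2 : (2 : ℝ) ^ n ≠ 0 := by positivity
  unfold dyadicMidpoint
  rw [show 2 ^ (n + 1) = 2 ^ n + 2 ^ n by ring, sum_Icc_one_add, mul_add,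
    add_div, pow_succ]
  congr 1
  · rw [Finset.mul_sum, Finset.mul_sum, Finset.sum_div]
    refine Finset.sum_congr rfl fun i _ => ?_
    rw [show a + ((i : ℝ) - 1 / 2) * ((b - a) / (2 ^ n * 2))
      = a + ((i : ℝ) - 1 / 2) * (((a + b) / 2 - a) / 2 ^ n) by field_simp; ring]
    field_simp
  · rw [Finset.mul_sum, Finset.mul_sum, Finset.sum_div]
    refine Finset.sum_congr rfl fun i _ => ?_
    rw [show a + (((2 ^ n + i : ℕ) : ℝ) - 1 / 2) * ((b - a) / (2 ^ n * 2))
      = (a + b) / 2 + ((i : ℝ) - 1 / 2) * ((b - (a + b) / 2) / 2 ^ n) by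
        push_cast; field_simp; ring]
    field_simp

theorem dyadicTrapezoid_succ (F : ℝ → ℝ) (a b : ℝ) (n : ℕ) :
    dyadicTrapezoid F a b (n + 1)
      = (dyadicTrapezoid F a ((a + b) / 2) n + dyadicTrapezoid F ((a + b) / 2) b n) / 2 := by
  have h2 : (2 : ℝ) ^ n ≠ 0 := by positivity
  obtain ⟨k, hk⟩ : ∃ k : ℕ, 2 ^ n = k + 1 :=
    ⟨2 ^ n - 1, by have := Nat.one_le_two_pow (n := n); omega⟩
  have hkr : (2 : ℝ) ^ n = k + 1 := by exact_mod_cast hk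
  -- Of the `2k + 1` interior nodes, number `k + 1` is the centre, which becomes an end point of
  -- both halves.
  have e1 : 2 ^ (n + 1) - 1 = (k + 1) + k := by rw [pow_succ, hk]; omega
  have e2 : 2 ^ n - 1 = k := by omega
  unfold dyadicTrapezoid
  rw [e1, e2, sum_Icc_one_add, Finset.sum_Icc_succ_top (by omega)]
  have s1 : ∑ i ∈ Finset.Icc 1 k, F ((1 - (i : ℝ) / 2 ^ (n + 1)) * a + (i : ℝ) / 2 ^ (n + 1) * b)
      = ∑ i ∈ Finset.Icc 1 k,
        F ((1 - (i : ℝ) / 2 ^ n) * a + (i : ℝ) / 2 ^ n * ((a + b) / 2)) := by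
    refine Finset.sum_congr rfl fun i _ => congrArg F ?_
    rw [pow_succ]; field_simp; ring
  have s2 : ∑ i ∈ Finset.Icc 1 k, F ((1 - ((k + 1 + i : ℕ) : ℝ) / 2 ^ (n + 1)) * a
        + ((k + 1 + i : ℕ) : ℝ) / 2 ^ (n + 1) * b)
      = ∑ i ∈ Finset.Icc 1 k,
        F ((1 - (i : ℝ) / 2 ^ n) * ((a + b) / 2) + (i : ℝ) / 2 ^ n * b) := by
    refine Finset.sum_congr rfl fun i _ => congrArg F ?_
    push_cast
    rw [pow_succ, ← hkr]; field_simp; ring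
  have s3 : F ((1 - ((k + 1 : ℕ) : ℝ) / 2 ^ (n + 1)) * a + ((k + 1 : ℕ) : ℝ) / 2 ^ (n + 1) * b)
      = F ((a + b) / 2) := by
    congr 1
    push_cast
    rw [pow_succ, ← hkr]; field_simp; ring
  rw [s1, s2, s3, pow_succ]
  generalize ∑ i ∈ Finset.Icc 1 k,
    F ((1 - (i : ℝ) / 2 ^ n) * a + (i : ℝ) / 2 ^ n * ((a + b) / 2)) = S
  generalize ∑ i ∈ Finset.Icc 1 k,
    F ((1 - (i : ℝ) / 2 ^ n) * ((a + b) / 2) + (i : ℝ) / 2 ^ n * b) = T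
  field_simp
  ring

/-- The nodes added by refining the trapezoidal grid are exactly the midpoints used by
`dyadicMidpoint`. This makes the two limits coincide. -/
theorem dyadicTrapezoid_succ_eq (F : ℝ → ℝ) (n : ℕ) (a b : ℝ) :
    dyadicTrapezoid F a b (n + 1) = (dyadicMidpoint F a b n + dyadicTrapezoid F a b n) / 2 := by
  induction n generalizing a b with
  | zero =>
    rw [dyadicTrapezoid_succ]
    simp only [dyadicTrapezoid_zero, dyadicMidpoint_zero]
    ring
  | succ n ih =>
    rw [dyadicTrapezoid_succ, ih, ih, dyadicMidpoint_succ, dyadicTrapezoid_succ F a b n]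
    ring

theorem integralMean_split {F : ℝ → ℝ} {a b : ℝ} (h : IntervalIntegrable F volume a b)
    (hab : a ≤ b) :
    integralMean F a b
      = (integralMean F a ((a + b) / 2) + integralMean F ((a + b) / 2) b) / 2 := by
  rcases hab.eq_or_lt with rfl | hlt
  · simp [integralMean]
  have hm1 : a < (a + b) / 2 := by linarith
  have hm2 : (a + b) / 2 < b := by linarith
  have hd : b - a ≠ 0 := (sub_pos.2 hlt).ne'
  have hadd := intervalIntegral.integral_add_adjacent_intervals
    (h.mono_set (c := a) (d := (a + b) / 2)
      (by rw [uIcc_of_le hm1.le, uIcc_of_le hab]; exact Icc_subset_Icc_right hm2.le))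
    (h.mono_set (c := (a + b) / 2) (d := b)
      (by rw [uIcc_of_le hm2.le, uIcc_of_le hab]; exact Icc_subset_Icc_left hm1.le))
  unfold integralMean
  rw [if_neg hlt.ne, if_neg hm1.ne, if_neg hm2.ne, ← hadd,
    show (a + b) / 2 - a = (b - a) / 2 by ring, show b - (a + b) / 2 = (b - a) / 2 by ring]
  field_simp

section Halves

variable {F : ℝ → ℝ} {a b : ℝ}

theorem ConvexOn.left_half (hab : a ≤ b) (hF : ConvexOn ℝ (Icc a b) F) :
    ConvexOn ℝ (Icc a ((a + b) / 2)) F :=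
  hF.subset (Icc_subset_Icc_right (by linarith)) (convex_Icc _ _)

theorem ConvexOn.right_half (hab : a ≤ b) (hF : ConvexOn ℝ (Icc a b) F) :
    ConvexOn ℝ (Icc ((a + b) / 2) b) F :=
  hF.subset (Icc_subset_Icc_left (by linarith)) (convex_Icc _ _)

/-- All quantities on an interval are averages of those on its two halves, so the inequalities
propagate from `n = 0`, where they are Hermite–Hadamard and midpoint convexity. -/
theorem ConvexOn.dyadic_bounds (n : ℕ) (hab : a ≤ b) (hF : ConvexOn ℝ (Icc a b) F) :
    dyadicMidpoint F a b n ≤ dyadicMidpoint F a b (n + 1) ∧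
      dyadicMidpoint F a b n ≤ integralMean F a b ∧
      integralMean F a b ≤ dyadicTrapezoid F a b n ∧
      dyadicTrapezoid F a b (n + 1) ≤ dyadicTrapezoid F a b n := by
  induction n generalizing a b with
  | zero =>
    have hh := hF.hermite_hadamard hab
    have h1 := hF.map_midpoint_le (x := (a + (a + b) / 2) / 2) (y := ((a + b) / 2 + b) / 2)
      ⟨by linarith, by linarith⟩ ⟨by linarith, by linarith⟩
    have h2 := hF.map_midpoint_le (left_mem_Icc.2 hab) (right_mem_Icc.2 hab)
    rw [show ((a + (a + b) / 2) / 2 + ((a + b) / 2 + b) / 2) / 2 = (a + b) / 2 by ring] at h1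
    rw [dyadicMidpoint_succ, dyadicTrapezoid_succ]
    simp only [dyadicMidpoint_zero, dyadicTrapezoid_zero]
    exact ⟨h1, hh.1, hh.2, by linarith⟩
  | succ n ih =>
    obtain ⟨l1, l2, l3, l4⟩ := ih (by linarith) (hF.left_half hab)
    obtain ⟨r1, r2, r3, r4⟩ := ih (by linarith) (hF.right_half hab)
    rw [dyadicMidpoint_succ F a b (n + 1), dyadicTrapezoid_succ F a b (n + 1),
      dyadicMidpoint_succ F a b n, dyadicTrapezoid_succ F a b n,
      integralMean_split (hF.intervalIntegrable_Icc hab) hab]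
    exact ⟨by linarith, by linarith, by linarith, by linarith⟩

theorem ConvexOn.tendsto_dyadicTrapezoid (hab : a ≤ b) (hF : ConvexOn ℝ (Icc a b) F) :
    Filter.Tendsto (dyadicTrapezoid F a b) Filter.atTop (nhds (integralMean F a b)) ∧
      Filter.Tendsto (dyadicMidpoint F a b) Filter.atTop (nhds (integralMean F a b)) := by
  have hB := fun n => hF.dyadic_bounds n hab
  have hy : Filter.Tendsto (dyadicTrapezoid F a b) Filter.atTop
      (nhds (⨅ n, dyadicTrapezoid F a b n)) :=
    tendsto_atTop_ciInf (antitone_nat_of_succ_le fun n => (hB n).2.2.2)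
      ⟨integralMean F a b, by rintro _ ⟨n, rfl⟩; exact (hB n).2.2.1⟩
  set l := ⨅ n, dyadicTrapezoid F a b n
  have hx : Filter.Tendsto (dyadicMidpoint F a b) Filter.atTop (nhds l) := by
    -- `x_n = 2 y_(n+1) - y_n` has the same limit as `y_n`, and the mean is squeezed between them.
    have := ((hy.comp (Filter.tendsto_add_atTop_nat 1)).const_mul 2).sub hy
    rw [show 2 * l - l = l by ring] at this
    refine this.congr fun n => ?_
    simp only [Function.comp_apply, dyadicTrapezoid_succ_eq]
    ring
  have hl : l = integralMean F a b :=
    le_antisymm (le_of_tendsto' hx fun n => (hB n).2.1) (ge_of_tendsto' hy fun n => (hB n).2.2.1)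
  rw [← hl]
  exact ⟨hy, hx⟩

end Halves

end HermiteHadamard

/-! ### One-parameter groups isometric on the imaginary axis. -/

section Dissipative

open Filter Topology

variable {J : Type*} [NormedAddCommGroup J] [NormedSpace ℂ J]

/-- If the infinitesimal generator `δ` of a group `Φ` of operators acts isometrically along the
imaginary axis, then `δ - z` is bounded below by `‖z‖` for purely imaginary `z`. -/
theorem norm_mul_le_of_isometric_group {Φ : ℂ → J →L[ℂ] J} {δ : J →L[ℂ] J}
    (h0 : Φ 0 = 1) (hd : HasDerivAt Φ δ 0) (hiso : ∀ (t : ℝ) (y : J), ‖Φ (t * Complex.I) y‖ = ‖y‖)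
    {z : ℂ} (hz : z.re = 0) (y : J) : ‖z‖ * ‖y‖ ≤ ‖δ y - z • y‖ := by
  obtain ⟨r, rfl⟩ : ∃ r : ℝ, z = r * Complex.I :=
    ⟨z.im, by apply Complex.ext <;> simp [hz]⟩
  have hc : HasDerivAt (fun t : ℝ => Φ (t * Complex.I) y) ((Complex.I • δ) y) 0 := by
    have h1 : HasDerivAt (fun t : ℝ => (t : ℂ) * Complex.I) Complex.I 0 := by
      simpa using (Complex.ofRealCLM.hasDerivAt (x := (0 : ℝ))).mul_const Complex.I
    have h2 : HasDerivAt Φ δ ((0 : ℝ) * Complex.I) := by simpa using hd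
    have h3 := h2.scomp (0 : ℝ) h1
    exact ((ContinuousLinearMap.apply ℂ J y).restrictScalars ℝ).hasFDerivAt.comp_hasDerivAt _ h3
  have hslope := hc.tendsto_slope_zero
  have h00 : Φ (((0 : ℝ) : ℂ) * Complex.I) y = y := by simp [h0]
  simp only [zero_add, h00] at hslope
  -- choose the sign of the increment so that it is opposite to that of `r`
  have key : ∀ t : ℝ, t ≠ 0 → t * r ≤ 0 → |r| * ‖y‖ ≤
      ‖t⁻¹ • (Φ (t * Complex.I) y - y) + r • y‖ := by
    intro t ht htr
    have e : t⁻¹ • (Φ (t * Complex.I) y - y) + r • y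
        = t⁻¹ • Φ (t * Complex.I) y - (t⁻¹ - r) • y := by
      rw [smul_sub, sub_smul]; abel
    -- By isometry the reverse triangle inequality leaves `|t⁻¹ - r| - |t⁻¹|`, which is `|r|` since
    -- `t` and `r` have opposite signs.
    rw [e, norm_sub_rev]
    refine le_trans ?_ (norm_sub_norm_le _ _)
    rw [norm_smul, norm_smul, hiso, ← sub_mul]
    refine mul_le_mul_of_nonneg_right ?_ (norm_nonneg _)
    rw [Real.norm_eq_abs, Real.norm_eq_abs]
    rcases lt_or_gt_of_ne ht with h | h
    · have hr : 0 ≤ r := by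
        by_contra hr
        push Not at hr
        nlinarith [mul_pos_of_neg_of_neg h hr]
      have hi : t⁻¹ < 0 := inv_lt_zero.2 h
      rw [abs_of_nonneg hr, abs_of_neg hi, abs_of_nonpos (by linarith)]
      linarith
    · have hr : r ≤ 0 := by
        by_contra hr
        push Not at hr
        nlinarith [mul_pos h hr]
      have hi : 0 < t⁻¹ := inv_pos.2 h
      rw [abs_of_nonpos hr, abs_of_pos hi, abs_of_nonneg (by linarith)]
      linarith
  have hlim : |r| * ‖y‖ ≤ ‖(Complex.I • δ) y + r • y‖ := by
    have hT := (hslope.add_const (r • y)).norm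
    rcases le_total 0 r with hr | hr
    · have hT' := hT.mono_left (nhdsWithin_mono (0 : ℝ) (s := Set.Iio 0)
        fun t ht => by simpa using (ne_of_lt ht))
      refine ge_of_tendsto hT' ?_
      filter_upwards [self_mem_nhdsWithin] with t ht
      exact key t (ne_of_lt ht) (mul_nonpos_of_nonpos_of_nonneg (le_of_lt ht) hr)
    · have hT' := hT.mono_left (nhdsWithin_mono (0 : ℝ) (s := Set.Ioi 0)
        fun t ht => by simpa using (ne_of_gt ht))
      refine ge_of_tendsto hT' ?_
      filter_upwards [self_mem_nhdsWithin] with t ht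
      exact key t (ne_of_gt ht) (mul_nonpos_of_nonneg_of_nonpos (le_of_lt ht) hr)
  have e : (Complex.I • δ) y + r • y = Complex.I • (δ y - (r * Complex.I) • y) := by
    rw [smul_sub, smul_smul, mul_left_comm, Complex.I_mul_I]
    simp
  rw [e, norm_smul] at hlim
  simpa using hlim

/-- A polynomial all of whose roots are purely imaginary, evaluated at such an operator `δ`, is
bounded below by its constant term. -/
theorem norm_eval_zero_mul_le {δ : J →L[ℂ] J}
    (hδ : ∀ z : ℂ, z.re = 0 → ∀ y, ‖z‖ * ‖y‖ ≤ ‖δ y - z • y‖) (n : ℕ) :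
    ∀ p : Polynomial ℂ, p.natDegree = n → (∀ z, p.IsRoot z → z.re = 0) → ∀ y,
      ‖p.eval 0‖ * ‖y‖ ≤ ‖Polynomial.aeval δ p y‖ := by
  induction n with
  | zero =>
    intro p hp _ y
    rw [Polynomial.eq_C_of_natDegree_eq_zero hp]
    simp [Algebra.algebraMap_eq_smul_one, norm_smul]
  | succ n ih =>
    intro p hp hroot y
    -- Each factor `X - z` contributes a factor `‖z‖` both to `‖p.eval 0‖` and to the lower bound.
    obtain ⟨z, hz⟩ := IsAlgClosed.exists_root p
      (fun h => by rw [Polynomial.natDegree_eq_zero_iff_degree_le_zero.2 h.le] at hp; omega)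
    obtain ⟨q, rfl⟩ := Polynomial.dvd_iff_isRoot.2 hz
    have hq0 : q ≠ 0 := by
      rintro rfl
      simp at hp
    have hqd : q.natDegree = n := by
      rw [Polynomial.natDegree_mul (Polynomial.X_sub_C_ne_zero z) hq0,
        Polynomial.natDegree_X_sub_C] at hp
      omega
    have h1 := ih q hqd (fun w hw => hroot w (by
      simp only [Polynomial.IsRoot, Polynomial.eval_mul] at hw ⊢
      rw [hw, mul_zero])) y
    have h2 := hδ z (hroot z hz) (Polynomial.aeval δ q y)
    have e : Polynomial.aeval δ ((Polynomial.X - Polynomial.C z) * q) y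
        = δ (Polynomial.aeval δ q y) - z • Polynomial.aeval δ q y := by
      simp [Algebra.algebraMap_eq_smul_one]
    rw [e]
    calc _ = ‖z‖ * (‖q.eval 0‖ * ‖y‖) := by simp [mul_assoc]
      _ ≤ ‖z‖ * ‖Polynomial.aeval δ q y‖ := mul_le_mul_of_nonneg_left h1 (norm_nonneg _)
      _ ≤ _ := h2

/-- Opposite `n`-th powers have equal moduli, so `z` is equidistant from `1/c` and `-1/c`. -/
theorem re_eq_zero_of_pow_add_pow_eq_zero {z : ℂ} {n : ℕ} {c : ℝ} (hn : n ≠ 0) (hc : c ≠ 0)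
    (h : (1 + c * z) ^ n + (1 - c * z) ^ n = 0) : z.re = 0 := by
  have h1 : ‖1 + c * z‖ = ‖1 - c * z‖ := by
    have : ‖(1 + c * z) ^ n‖ = ‖(1 - c * z) ^ n‖ := by
      rw [eq_neg_of_add_eq_zero_left h, norm_neg]
    rw [norm_pow, norm_pow] at this
    exact (pow_left_inj₀ (norm_nonneg _) (norm_nonneg _) hn).1 this
  have h2 : Complex.normSq (1 + c * z) = Complex.normSq (1 - c * z) := by
    rw [Complex.normSq_eq_norm_sq, Complex.normSq_eq_norm_sq, h1]
  simp only [Complex.normSq_apply, Complex.add_re, Complex.add_im, Complex.sub_re, Complex.sub_im,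
    Complex.one_re, Complex.one_im, Complex.re_ofReal_mul, Complex.im_ofReal_mul] at h2
  have : c * z.re = 0 := by linarith
  exact (mul_eq_zero.1 this).resolve_left hc

theorem two_mul_norm_le_pow_add_pow {δ : J →L[ℂ] J}
    (hδ : ∀ z : ℂ, z.re = 0 → ∀ y, ‖z‖ * ‖y‖ ≤ ‖δ y - z • y‖) {n : ℕ} (hn : n ≠ 0)
    {c : ℝ} (hc : c ≠ 0) (y : J) :
    2 * ‖y‖ ≤ ‖((1 + (c : ℂ) • δ) ^ n + (1 - (c : ℂ) • δ) ^ n) y‖ := by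
  set p : Polynomial ℂ := (1 + Polynomial.C (c : ℂ) * Polynomial.X) ^ n
    + (1 - Polynomial.C (c : ℂ) * Polynomial.X) ^ n with hp
  have h := norm_eval_zero_mul_le hδ _ p rfl (fun z hz => by
    refine re_eq_zero_of_pow_add_pow_eq_zero hn hc (z := z) ?_
    simpa [hp, Polynomial.IsRoot] using hz) y
  have e0 : p.eval 0 = 2 := by simp [hp]; norm_num
  have e1 : Polynomial.aeval δ p = (1 + (c : ℂ) • δ) ^ n + (1 - (c : ℂ) • δ) ^ n := by
    simp [hp, Algebra.algebraMap_eq_smul_one]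
  rw [e0, e1] at h
  simpa using h

/-- Euler's limit formula for a differentiable one-parameter group in a normed algebra. -/
theorem tendsto_one_add_smul_pow {E : Type*} [NormedRing E] [NormedAlgebra ℂ E] [NormOneClass E]
    {Φ : ℂ → E} {δ : E} (h0 : Φ 0 = 1) (hadd : ∀ z w, Φ (z + w) = Φ z * Φ w)
    (hd : HasDerivAt Φ δ 0) {M : ℝ} (hM : ∀ t : ℝ, 0 ≤ t → t ≤ 1 → ‖Φ t‖ ≤ M) :
    Tendsto (fun n : ℕ => (1 + (((n : ℝ)⁻¹ : ℝ) : ℂ) • δ) ^ n) atTop (𝓝 (Φ 1)) := by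
  have hpow : ∀ (z : ℂ) (k : ℕ), Φ z ^ k = Φ (k * z) := by
    intro z k
    induction k with
    | zero => simp [h0]
    | succ k ih => rw [pow_succ, ih, ← hadd]; push_cast; ring_nf
  have hM0 : 0 ≤ M := (norm_nonneg _).trans (hM 0 le_rfl zero_le_one)
  -- Telescoping compares `Φ(1/n)^n` with `(1 + δ/n)^n` directly, so no exponential series in the
  -- possibly incomplete `E` is needed. The `n` summands are offset by `‖Φ ε - (1 + εδ)‖ = n⁻¹
  -- ‖ε⁻¹(Φ ε - 1) - δ‖`.
  have tele : ∀ (a b : E) (c d : ℝ) (n : ℕ), 0 ≤ d → (∀ k ≤ n, ‖a ^ k‖ ≤ c) →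
      (∀ k ≤ n, ‖b ^ k‖ ≤ d) → 0 ≤ c → ‖a ^ n - b ^ n‖ ≤ n * (c * ‖a - b‖ * d) := by
    intro a b c d n hd hA hB hc
    have hsum : a ^ n - b ^ n = ∑ k ∈ Finset.range n, a ^ k * (a - b) * b ^ (n - 1 - k) := by
      clear hA hB
      induction n with
      | zero => simp
      | succ n ih =>
        rw [Finset.sum_range_succ]
        have : ∑ k ∈ Finset.range n, a ^ k * (a - b) * b ^ (n + 1 - 1 - k)
            = (∑ k ∈ Finset.range n, a ^ k * (a - b) * b ^ (n - 1 - k)) * b := by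
          rw [Finset.sum_mul]
          refine Finset.sum_congr rfl fun k hk => ?_
          rw [Finset.mem_range] at hk
          rw [mul_assoc _ _ b, ← pow_succ]
          congr 2
          omega
        rw [this, ← ih]
        simp only [add_tsub_cancel_right, tsub_self, pow_zero, mul_one, pow_succ]
        noncomm_ring
    rw [hsum]
    refine (norm_sum_le _ _).trans ?_
    calc _ ≤ ∑ k ∈ Finset.range n, c * ‖a - b‖ * d := by
          refine Finset.sum_le_sum fun k hk => ?_
          rw [Finset.mem_range] at hk
          refine (norm_mul_le _ _).trans ?_
          refine mul_le_mul ((norm_mul_le _ _).trans ?_) (hB _ (by omega)) (norm_nonneg _)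
            (mul_nonneg hc (norm_nonneg _))
          exact mul_le_mul_of_nonneg_right (hA _ (by omega)) (norm_nonneg _)
      _ = _ := by simp
  have hbound : ∀ᶠ n : ℕ in atTop,
      ‖(1 + (((n : ℝ)⁻¹ : ℝ) : ℂ) • δ) ^ n - Φ 1‖
        ≤ M * Real.exp ‖δ‖ * ‖(((n : ℝ)⁻¹ : ℝ) : ℂ)⁻¹ • (Φ (((n : ℝ)⁻¹ : ℝ) : ℂ) - 1) - δ‖ := by
    filter_upwards [eventually_gt_atTop 0] with n hn
    have hn' : (0 : ℝ) < n := Nat.cast_pos.2 hn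
    have hnc : (n : ℂ) ≠ 0 := by exact_mod_cast hn.ne'
    set ε : ℂ := (((n : ℝ)⁻¹ : ℝ) : ℂ) with hε
    have hεn : (n : ℂ) * ε = 1 := by rw [hε]; push_cast; exact mul_inv_cancel₀ hnc
    have hε0 : ε ≠ 0 := by rintro h; simp [h] at hεn
    have hεnorm : ‖ε‖ = (n : ℝ)⁻¹ := by simp [hε]
    have hA : ∀ k ≤ n, ‖Φ ε ^ k‖ ≤ M := by
      intro k hk
      rw [hpow, show (k : ℂ) * ε = ((k * (n : ℝ)⁻¹ : ℝ) : ℂ) by rw [hε]; push_cast; ring]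
      refine hM _ (by positivity) ?_
      rw [← div_eq_mul_inv, div_le_one hn']
      exact_mod_cast hk
    have hB : ∀ k ≤ n, ‖(1 + ε • δ) ^ k‖ ≤ Real.exp ‖δ‖ := by
      intro k hk
      have hb : ‖1 + ε • δ‖ ≤ Real.exp ((n : ℝ)⁻¹ * ‖δ‖) := by
        refine (norm_add_le _ _).trans ?_
        rw [norm_one, norm_smul, hεnorm, add_comm]
        exact Real.add_one_le_exp _
      calc ‖(1 + ε • δ) ^ k‖ ≤ ‖1 + ε • δ‖ ^ k := norm_pow_le _ _
        _ ≤ Real.exp ((n : ℝ)⁻¹ * ‖δ‖) ^ k := pow_le_pow_left₀ (norm_nonneg _) hb _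
        _ = Real.exp (k * ((n : ℝ)⁻¹ * ‖δ‖)) := (Real.exp_nat_mul _ _).symm
        _ ≤ Real.exp ‖δ‖ := by
          refine Real.exp_le_exp.2 ?_
          rw [← mul_assoc]
          refine mul_le_of_le_one_left (norm_nonneg _) ?_
          rw [← div_eq_mul_inv, div_le_one hn']
          exact_mod_cast hk
    have h1 := tele (Φ ε) (1 + ε • δ) M (Real.exp ‖δ‖) n (Real.exp_nonneg _) hA hB hM0
    rw [hpow, hεn, norm_sub_rev] at h1
    refine h1.trans (le_of_eq ?_)
    have e : Φ ε - (1 + ε • δ) = ε • (ε⁻¹ • (Φ ε - 1) - δ) := by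
      rw [smul_sub, smul_smul, mul_inv_cancel₀ hε0, one_smul]; abel
    rw [e, norm_smul, hεnorm]
    field_simp
  have hslope : Tendsto (fun n : ℕ => ‖(((n : ℝ)⁻¹ : ℝ) : ℂ)⁻¹ •
      (Φ (((n : ℝ)⁻¹ : ℝ) : ℂ) - 1) - δ‖) atTop (𝓝 0) := by
    have hs := hd.tendsto_slope_zero
    simp only [zero_add, h0] at hs
    have hto : Tendsto (fun n : ℕ => (((n : ℝ)⁻¹ : ℝ) : ℂ)) atTop (𝓝[≠] 0) := by
      refine tendsto_nhdsWithin_iff.2 ⟨?_, ?_⟩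
      · have := (Complex.continuous_ofReal.tendsto 0).comp
          (tendsto_inv_atTop_nhds_zero_nat (𝕜 := ℝ))
        simpa only [Complex.ofReal_zero, Function.comp_def] using this
      · filter_upwards [eventually_gt_atTop 0] with n hn
        simpa using hn.ne'
    have := ((hs.comp hto).sub_const δ).norm
    simpa using this
  rw [tendsto_iff_norm_sub_tendsto_zero]
  refine squeeze_zero' (Eventually.of_forall fun n => norm_nonneg _) hbound ?_
  simpa using hslope.const_mul (M * Real.exp ‖δ‖)

/-- The Corach–Porta–Recht inequality for a one-parameter group of operators that is isometric
along the imaginary axis. -/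
theorem two_mul_norm_le_of_isometric_group {Φ : ℂ → J →L[ℂ] J} {δ : J →L[ℂ] J}
    (h0 : Φ 0 = 1) (hadd : ∀ z w, Φ (z + w) = Φ z * Φ w) (hd : HasDerivAt Φ δ 0)
    (hcont : Continuous Φ) (hiso : ∀ (t : ℝ) (y : J), ‖Φ (t * Complex.I) y‖ = ‖y‖) (y : J) :
    2 * ‖y‖ ≤ ‖Φ 1 y + Φ (-1) y‖ := by
  -- The identity of `J →L[ℂ] J` has norm `1` only for nontrivial `J`.
  rcases subsingleton_or_nontrivial J with hJ | hJ
  · simp [Subsingleton.elim y 0]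
  obtain ⟨M, hM⟩ := (isCompact_Icc (a := (-1 : ℝ)) (b := 1)).exists_bound_of_continuousOn
    (f := fun t : ℝ => Φ t) (by fun_prop)
  have hp := tendsto_one_add_smul_pow h0 hadd hd (M := M)
    fun t h h' => hM t ⟨by linarith, h'⟩
  -- The same limit formula for the inverse group, whose generator is `-δ`.
  have hm := tendsto_one_add_smul_pow (Φ := fun z => Φ (-z)) (δ := -δ) (by simpa using h0)
    (fun z w => by simp only [neg_add]; exact hadd _ _)
    (by
      have h := HasDerivAt.scomp (0 : ℂ) (g₁ := Φ) (h := fun z : ℂ => -z) (h' := -1)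
        (by simpa using hd) (hasDerivAt_neg (0 : ℂ))
      simpa [Function.comp_def] using h) (M := M)
    fun t h h' => by
      have := hM (-t) ⟨by linarith, by linarith⟩
      simpa using this
  have hlim := ((ContinuousLinearMap.apply ℂ J y).continuous.tendsto _).comp (hp.add hm)
  refine ge_of_tendsto hlim.norm ?_
  filter_upwards [eventually_gt_atTop 0] with n hn
  have := two_mul_norm_le_pow_add_pow
    (fun z hz y => norm_mul_le_of_isometric_group h0 hd hiso hz y) hn.ne'
    (c := (n : ℝ)⁻¹) (by positivity) y
  simpa [sub_eq_add_neg] using this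

end Dissipative

/-! ### The ideal as a normed space and the arithmetic–geometric mean inequality. -/

namespace UnitarilyInvariantNorm

open Filter Topology

variable {H : Type*} [NormedAddCommGroup H] [InnerProductSpace ℂ H] [CompleteSpace H]
  (N : UnitarilyInvariantNorm H)

theorem val_zero : N.val 0 = 0 := by
  simpa using N.val_smul 0 0 N.ideal.zero_mem

theorem val_nonneg {X : H →L[ℂ] H} (hX : X ∈ N.ideal) : 0 ≤ N.val X := by
  have h1 := N.val_smul (-1) X hX
  have h2 := N.val_add_le X hX _ (N.ideal.smul_mem (-1) hX)
  rw [show X + (-1 : ℂ) • X = 0 by module, N.val_zero, h1] at h2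
  norm_num at h2
  linarith

theorem val_sum_le {ι : Type*} (s : Finset ι) (f : ι → H →L[ℂ] H) (hf : ∀ i, f i ∈ N.ideal) :
    N.val (∑ i ∈ s, f i) ≤ ∑ i ∈ s, N.val (f i) := by
  classical
  induction s using Finset.induction_on with
  | empty => simp [N.val_zero]
  | insert i s hi ih =>
    rw [Finset.sum_insert hi, Finset.sum_insert hi]
    exact (N.val_add_le _ (hf i) _ (N.ideal.sum_mem fun j _ => hf j)).trans
      (add_le_add_right ih _)

theorem val_unitary_mul {U X : H →L[ℂ] H} (hU : U ∈ unitary (H →L[ℂ] H)) (hX : X ∈ N.ideal) :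
    N.val (U * X) = N.val X := by
  simpa using N.val_unitary_mul_mul U hU 1 (one_mem _) X hX

theorem val_mul_unitary {V X : H →L[ℂ] H} (hV : V ∈ unitary (H →L[ℂ] H)) (hX : X ∈ N.ideal) :
    N.val (X * V) = N.val X := by
  simpa using N.val_unitary_mul_mul 1 (one_mem _) V hV X hX

/-- `S` is a combination of four unitaries with coefficients at most `‖S‖ / 2`. The constant is not
sharp; only continuity of multiplication is used. -/
theorem val_mul_left_le (S : H →L[ℂ] H) {X : H →L[ℂ] H} (hX : X ∈ N.ideal) :
    N.val (S * X) ≤ 2 * ‖S‖ * N.val X := by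
  obtain ⟨u, c, hS, hc⟩ := CStarAlgebra.exists_sum_four_unitary S
  conv_lhs => rw [hS, Finset.sum_mul]
  refine (N.val_sum_le _ _ fun i => N.mul_mem_left _ _ hX).trans ?_
  calc _ ≤ ∑ _i : Fin 4, ‖S‖ / 2 * N.val X := by
        refine Finset.sum_le_sum fun i _ => ?_
        rw [smul_mul_assoc, N.val_smul _ _ (N.mul_mem_left _ _ hX), N.val_unitary_mul (u i).2 hX]
        exact mul_le_mul_of_nonneg_right (hc i) (N.val_nonneg hX)
    _ = _ := by simp; ring

theorem val_mul_right_le (S : H →L[ℂ] H) {X : H →L[ℂ] H} (hX : X ∈ N.ideal) :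
    N.val (X * S) ≤ 2 * ‖S‖ * N.val X := by
  obtain ⟨u, c, hS, hc⟩ := CStarAlgebra.exists_sum_four_unitary S
  conv_lhs => rw [hS, Finset.mul_sum]
  refine (N.val_sum_le _ _ fun i => N.mul_mem_right _ _ hX).trans ?_
  calc _ ≤ ∑ _i : Fin 4, ‖S‖ / 2 * N.val X := by
        refine Finset.sum_le_sum fun i _ => ?_
        rw [mul_smul_comm, N.val_smul _ _ (N.mul_mem_right _ _ hX), N.val_mul_unitary (u i).2 hX]
        exact mul_le_mul_of_nonneg_right (hc i) (N.val_nonneg hX)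
    _ = _ := by simp; ring

/-- The norm ideal of a unitarily invariant norm, as a normed space with that norm. -/
def Carrier : Type _ := N.ideal

instance : AddCommGroup N.Carrier := inferInstanceAs (AddCommGroup N.ideal)

instance : Module ℂ N.Carrier := inferInstanceAs (Module ℂ N.ideal)

/-- The separate type keeps this norm apart from the operator norm inherited by the submodule. -/
instance : Norm N.Carrier := ⟨fun X => N.val (Subtype.val X)⟩

theorem normedSpaceCore : NormedSpace.Core ℂ N.Carrier where
  norm_nonneg X := N.val_nonneg X.2
  norm_smul c X := N.val_smul c _ X.2
  norm_triangle X Y := N.val_add_le _ X.2 _ Y.2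
  norm_eq_zero_iff X := by
    refine ⟨fun h => Subtype.ext (N.eq_zero_of_val_eq_zero _ X.2 h), ?_⟩
    rintro rfl
    exact N.val_zero

noncomputable instance : NormedAddCommGroup N.Carrier :=
  NormedAddCommGroup.ofCore N.normedSpaceCore

noncomputable instance : NormedSpace ℂ N.Carrier := NormedSpace.ofCore N.normedSpaceCore

/-- An operator of the ideal, as an element of the normed space `N.Carrier`. -/
def toCarrier (X : H →L[ℂ] H) (hX : X ∈ N.ideal) : N.Carrier := ⟨X, hX⟩

/-- Multiplication from the left on the norm ideal. -/
noncomputable def leftMul : (H →L[ℂ] H) →L[ℂ] N.Carrier →L[ℂ] N.Carrier :=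
  LinearMap.mkContinuous₂
    (LinearMap.mk₂ ℂ (fun S X => N.toCarrier (S * X.1) (N.mul_mem_left _ _ X.2))
      (fun _ _ _ => Subtype.ext (add_mul _ _ _)) (fun _ _ _ => Subtype.ext (smul_mul_assoc _ _ _))
      (fun _ _ _ => Subtype.ext (mul_add _ _ _)) (fun _ _ _ => Subtype.ext (mul_smul_comm _ _ _)))
    2 fun S X => N.val_mul_left_le S X.2

/-- Multiplication from the right on the norm ideal. -/
noncomputable def rightMul : (H →L[ℂ] H) →L[ℂ] N.Carrier →L[ℂ] N.Carrier :=
  LinearMap.mkContinuous₂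
    (LinearMap.mk₂ ℂ (fun S X => N.toCarrier (X.1 * S) (N.mul_mem_right _ _ X.2))
      (fun _ _ _ => Subtype.ext (mul_add _ _ _)) (fun _ _ _ => Subtype.ext (mul_smul_comm _ _ _))
      (fun _ _ _ => Subtype.ext (add_mul _ _ _)) (fun _ _ _ => Subtype.ext (smul_mul_assoc _ _ _)))
    2 fun S X => N.val_mul_right_le S X.2

theorem leftMul_coe (S : H →L[ℂ] H) (X : N.Carrier) : (N.leftMul S X).1 = S * X.1 := rfl

theorem rightMul_coe (S : H →L[ℂ] H) (X : N.Carrier) : (N.rightMul S X).1 = X.1 * S := rfl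

/-- The arithmetic–geometric mean inequality for `exp h`, `exp k` with `h`, `k` self-adjoint, in
the form of the Corach–Porta–Recht inequality. -/
theorem two_mul_norm_le_exp {h k : H →L[ℂ] H} (hh : IsSelfAdjoint h) (hk : IsSelfAdjoint k)
    (Y : N.Carrier) :
    2 * ‖Y‖ ≤ ‖N.leftMul (NormedSpace.exp h) (N.rightMul (NormedSpace.exp (-k)) Y)
      + N.leftMul (NormedSpace.exp (-h)) (N.rightMul (NormedSpace.exp k) Y)‖ := by
  let _ : NormedAlgebra ℚ (H →L[ℂ] H) := NormedAlgebra.restrictScalars ℚ ℂ _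
  set Φ : ℂ → N.Carrier →L[ℂ] N.Carrier := fun z =>
    N.leftMul (NormedSpace.exp (z • h)) * N.rightMul (NormedSpace.exp (z • (-k))) with hΦ
  have hexp : ∀ (x : H →L[ℂ] H) (z w : ℂ), NormedSpace.exp ((z + w) • x)
      = NormedSpace.exp (z • x) * NormedSpace.exp (w • x) := fun x z w => by
    rw [add_smul, NormedSpace.exp_add_of_commute
      (((Commute.refl x).smul_left z).smul_right w)]
  have hderiv : ∀ x : H →L[ℂ] H, ∀ z : ℂ, HasDerivAt (fun z : ℂ => NormedSpace.exp (z • x))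
      (NormedSpace.exp (z • x) * x) z := fun x z => hasDerivAt_exp_smul_const x z
  have hD : ∀ z, HasDerivAt Φ _ z := fun z =>
    ((N.leftMul.hasFDerivAt.comp_hasDerivAt z (hderiv h z)).mul
      (N.rightMul.hasFDerivAt.comp_hasDerivAt z (hderiv (-k) z)))
  have hunit : ∀ (x : H →L[ℂ] H), IsSelfAdjoint x → ∀ t : ℝ,
      NormedSpace.exp (((t : ℂ) * Complex.I) • x) ∈ unitary (H →L[ℂ] H) := fun x hx t =>
    NormedSpace.exp_mem_unitary_of_mem_skewAdjoint (hx.smul_mem_skewAdjoint (by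
      simp [skewAdjoint.mem_iff]))
  have key := two_mul_norm_le_of_isometric_group (Φ := Φ) ?_ ?_ (hD 0)
    (continuous_iff_continuousAt.2 fun z => (hD z).continuousAt) ?_ Y
  · simpa [hΦ] using key
  · ext Y
    refine Subtype.ext ?_
    simp [hΦ, leftMul_coe, rightMul_coe]
  · intro z w
    ext Y
    refine Subtype.ext ?_
    simp only [hΦ, mul_apply_eq_comp, leftMul_coe, rightMul_coe]
    rw [hexp h z w, add_comm z w, hexp (-k) w z]
    noncomm_ring
  · intro t Y
    exact N.val_unitary_mul (hunit h hh t) (N.mul_mem_right _ _ Y.2) |>.trans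
      (N.val_mul_unitary (hunit (-k) hk.neg t) Y.2)

/-- Put `h = log P`, `k = log Q` and `Y = PZQ`: then `e^h Y e^(-k) = P²Z` and `e^(-h) Y e^k = ZQ²`.
-/
theorem two_mul_norm_le_of_isStrictlyPositive {P Q : H →L[ℂ] H} (hP : IsStrictlyPositive P)
    (hQ : IsStrictlyPositive Q) (Z : N.Carrier) :
    2 * ‖N.leftMul P (N.rightMul Q Z)‖ ≤ ‖N.leftMul (P * P) Z + N.rightMul (Q * Q) Z‖ := by
  let _ : NormedAlgebra ℚ (H →L[ℂ] H) := NormedAlgebra.restrictScalars ℚ ℂ _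
  have h := N.two_mul_norm_le_exp (h := CFC.log P) (k := CFC.log Q) .log .log
    (N.leftMul P (N.rightMul Q Z))
  have hinv : ∀ x : H →L[ℂ] H, NormedSpace.exp x * NormedSpace.exp (-x) = 1 := fun x => by
    rw [← NormedSpace.exp_add_of_commute (Commute.refl x).neg_right]; simp
  have hP' := hinv (-CFC.log P)
  have hQ' := hinv (CFC.log Q)
  rw [neg_neg] at hP'
  rw [CFC.exp_log P] at h hP'
  rw [CFC.exp_log Q] at h hQ'
  convert! h using 3
  · refine Subtype.ext ?_
    simp only [leftMul_coe, rightMul_coe]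
    rw [mul_assoc, mul_assoc, mul_assoc, hQ', mul_one]
  · refine Subtype.ext ?_
    simp only [leftMul_coe, rightMul_coe]
    rw [← mul_assoc, ← mul_assoc, ← mul_assoc, hP', one_mul, mul_assoc]

/-- The arithmetic–geometric mean inequality for a unitarily invariant norm. -/
theorem two_mul_val_mul_mul_le {P Q Z : H →L[ℂ] H} (hP : 0 ≤ P) (hQ : 0 ≤ Q) (hZ : Z ∈ N.ideal) :
    2 * N.val (P * Z * Q) ≤ N.val (P * P * Z + Z * (Q * Q)) := by
  set z := N.toCarrier Z hZ
  -- Adding `ε` makes `P` and `Q` invertible; both sides are continuous as `ε → 0+`.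
  have hc : ∀ ε : ℝ, 0 < ε → 2 * ‖N.leftMul (P + (ε : ℂ) • 1) (N.rightMul (Q + (ε : ℂ) • 1) z)‖
      ≤ ‖N.leftMul ((P + (ε : ℂ) • 1) * (P + (ε : ℂ) • 1)) z
        + N.rightMul ((Q + (ε : ℂ) • 1) * (Q + (ε : ℂ) • 1)) z‖ := by
    intro ε hε
    have h1 : IsStrictlyPositive ((ε : ℂ) • (1 : H →L[ℂ] H)) := by
      rw [Complex.coe_smul]
      exact IsStrictlyPositive.smul hε isStrictlyPositive_one
    exact N.two_mul_norm_le_of_isStrictlyPositive (IsStrictlyPositive.nonneg_add hP h1)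
      (IsStrictlyPositive.nonneg_add hQ h1) z
  have hlim := le_of_tendsto_of_tendsto
    (b := 𝓝[>] (0 : ℝ))
    (f := fun ε : ℝ => 2 * ‖N.leftMul (P + (ε : ℂ) • 1) (N.rightMul (Q + (ε : ℂ) • 1) z)‖)
    (g := fun ε : ℝ => ‖N.leftMul ((P + (ε : ℂ) • 1) * (P + (ε : ℂ) • 1)) z
        + N.rightMul ((Q + (ε : ℂ) • 1) * (Q + (ε : ℂ) • 1)) z‖)
    ((Continuous.tendsto (by fun_prop) 0).mono_left nhdsWithin_le_nhds)
    ((Continuous.tendsto (by fun_prop) 0).mono_left nhdsWithin_le_nhds)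
    (by filter_upwards [self_mem_nhdsWithin] with ε hε using hc ε hε)
  simp only [Complex.ofReal_zero, zero_smul, add_zero] at hlim
  have e : N.val (P * Z * Q) = ‖N.leftMul P (N.rightMul Q z)‖ := by
    rw [mul_assoc]; rfl
  rw [e]
  exact hlim

end UnitarilyInvariantNorm

/-! ### Ky Fan norms as unitarily invariant norms on all bounded operators. -/

section KyFan

variable {H : Type*} [NormedAddCommGroup H] [InnerProductSpace ℂ H]

theorem kyFanNorm_bddAbove (k : ℕ) (X : H →L[ℂ] H) :
    BddAbove {r : ℝ | ∃ j : ℕ, j ≤ k ∧ ∃ e f : Fin j → H, Orthonormal ℂ e ∧ Orthonormal ℂ f ∧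
      r = ∑ i, ‖inner ℂ (f i) (X (e i))‖} := by
  refine ⟨k * ‖X‖, ?_⟩
  rintro _ ⟨j, hj, e, f, he, hf, rfl⟩
  calc ∑ i, ‖inner ℂ (f i) (X (e i))‖ ≤ ∑ _i : Fin j, ‖X‖ := by
        refine Finset.sum_le_sum fun i _ => (norm_inner_le_norm _ _).trans ?_
        rw [hf.1 i, one_mul]
        simpa [he.1 i] using X.le_opNorm (e i)
    _ = j * ‖X‖ := by simp
    _ ≤ k * ‖X‖ := by gcongr

theorem sum_norm_inner_le_kyFanNorm {j k : ℕ} (hj : j ≤ k) (X : H →L[ℂ] H) {e f : Fin j → H}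
    (he : Orthonormal ℂ e) (hf : Orthonormal ℂ f) :
    ∑ i, ‖inner ℂ (f i) (X (e i))‖ ≤ kyFanNorm k X :=
  le_csSup (kyFanNorm_bddAbove k X) ⟨j, hj, e, f, he, hf, rfl⟩

theorem kyFanNorm_le {k : ℕ} {X : H →L[ℂ] H} {c : ℝ}
    (h : ∀ j ≤ k, ∀ e f : Fin j → H, Orthonormal ℂ e → Orthonormal ℂ f →
      ∑ i, ‖inner ℂ (f i) (X (e i))‖ ≤ c) : kyFanNorm k X ≤ c := by
  refine csSup_le ⟨0, 0, Nat.zero_le _, Fin.elim0, Fin.elim0, ?_, ?_, by simp⟩ ?_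
  · exact ⟨fun i => i.elim0, fun i => i.elim0⟩
  · exact ⟨fun i => i.elim0, fun i => i.elim0⟩
  · rintro _ ⟨j, hj, e, f, he, hf, rfl⟩
    exact h j hj e f he hf

theorem kyFanNorm_zero_left (X : H →L[ℂ] H) : kyFanNorm 0 X = 0 := by
  refine le_antisymm (kyFanNorm_le fun j hj e f _ _ => ?_) ?_
  · obtain rfl : j = 0 := Nat.le_zero.1 hj
    simp
  · have := sum_norm_inner_le_kyFanNorm (le_refl 0) X (e := Fin.elim0) (f := Fin.elim0)
      ⟨fun i => i.elim0, fun i => i.elim0⟩ ⟨fun i => i.elim0, fun i => i.elim0⟩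
    simpa using this

theorem kyFanNorm_add_le (k : ℕ) (X Y : H →L[ℂ] H) :
    kyFanNorm k (X + Y) ≤ kyFanNorm k X + kyFanNorm k Y := by
  refine kyFanNorm_le fun j hj e f he hf => ?_
  calc _ ≤ ∑ i, (‖inner ℂ (f i) (X (e i))‖ + ‖inner ℂ (f i) (Y (e i))‖) := by
        refine Finset.sum_le_sum fun i _ => ?_
        rw [add_apply, inner_add_right]
        exact norm_add_le _ _
    _ ≤ _ := by
      rw [Finset.sum_add_distrib]
      exact add_le_add (sum_norm_inner_le_kyFanNorm hj X he hf)
        (sum_norm_inner_le_kyFanNorm hj Y he hf)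

theorem kyFanNorm_smul_le (k : ℕ) (c : ℂ) (X : H →L[ℂ] H) :
    kyFanNorm k (c • X) ≤ ‖c‖ * kyFanNorm k X := by
  refine kyFanNorm_le fun j hj e f he hf => ?_
  simp only [smul_apply, inner_smul_right, norm_mul]
  rw [← Finset.mul_sum]
  exact mul_le_mul_of_nonneg_left (sum_norm_inner_le_kyFanNorm hj X he hf) (norm_nonneg c)

theorem kyFanNorm_smul (k : ℕ) (c : ℂ) (X : H →L[ℂ] H) :
    kyFanNorm k (c • X) = ‖c‖ * kyFanNorm k X := by
  rcases eq_or_ne c 0 with rfl | hc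
  · refine le_antisymm (kyFanNorm_smul_le k 0 X) ?_
    simpa using sum_norm_inner_le_kyFanNorm (Nat.zero_le k) (0 : H →L[ℂ] H) (e := Fin.elim0)
      (f := Fin.elim0) ⟨fun i => i.elim0, fun i => i.elim0⟩ ⟨fun i => i.elim0, fun i => i.elim0⟩
  · refine le_antisymm (kyFanNorm_smul_le k c X) ?_
    have := kyFanNorm_smul_le k c⁻¹ (c • X)
    rw [smul_smul, inv_mul_cancel₀ hc, one_smul, norm_inv] at this
    rwa [← le_inv_mul_iff₀ (norm_pos_iff.2 hc)]

theorem eq_zero_of_kyFanNorm_eq_zero {k : ℕ} (hk : k ≠ 0) {X : H →L[ℂ] H}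
    (h : kyFanNorm k X = 0) : X = 0 := by
  ext x
  by_contra hx
  rw [zero_apply] at hx
  have hx0 : x ≠ 0 := by rintro rfl; simp at hx
  have hunit : ∀ y : H, y ≠ 0 → Orthonormal ℂ (fun _ : Fin 1 => ((‖y‖⁻¹ : ℝ) : ℂ) • y) :=
    fun y hy => ⟨fun _ => by simp [norm_smul, hy], fun i j hij => (hij (Subsingleton.elim i j)).elim⟩
  -- Testing with the families of length one `x/‖x‖` and `Xx/‖Xx‖` gives `‖Xx‖/‖x‖ ≤ 0`.
  have := sum_norm_inner_le_kyFanNorm (Nat.one_le_iff_ne_zero.2 hk) X (hunit x hx0) (hunit _ hx)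
  rw [h] at this
  simp only [map_smul, inner_smul_left, inner_smul_right, inner_self_eq_norm_sq_to_K] at this
  have hpos : 0 < ‖x‖ := norm_pos_iff.2 hx0
  have hpos' : 0 < ‖X x‖ := norm_pos_iff.2 hx
  have h2 : 0 < ‖x‖⁻¹ * (‖X x‖⁻¹ * ‖X x‖ ^ 2) := by positivity
  refine absurd ?_ (not_le.2 h2)
  simpa using this

variable [CompleteSpace H]

/-- `V` and `star U` carry the test families to orthonormal families. Equality follows by applying
this to the inverse unitaries. -/
theorem kyFanNorm_unitary_le (k : ℕ) {U V : H →L[ℂ] H} (hU : U ∈ unitary (H →L[ℂ] H))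
    (hV : V ∈ unitary (H →L[ℂ] H)) (X : H →L[ℂ] H) :
    kyFanNorm k (U * X * V) ≤ kyFanNorm k X := by
  have hpres : ∀ W : H →L[ℂ] H, W ∈ unitary (H →L[ℂ] H) → ∀ {j : ℕ} {e : Fin j → H},
      Orthonormal ℂ e → Orthonormal ℂ fun i => W (e i) := by
    intro W hW j e he
    exact he.comp_linearIsometry (Unitary.linearIsometryEquiv ⟨W, hW⟩).toLinearIsometry
  refine kyFanNorm_le fun j hj e f he hf => ?_
  have := sum_norm_inner_le_kyFanNorm hj X (hpres V hV he)
    (hpres (star U) (Unitary.star_mem hU) hf)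
  refine le_trans (le_of_eq ?_) this
  refine Finset.sum_congr rfl fun i _ => ?_
  rw [ContinuousLinearMap.star_eq_adjoint, ContinuousLinearMap.adjoint_inner_left]
  rfl

variable (H) in
/-- The `k`-th Ky Fan norm as a unitarily invariant norm on all bounded operators. -/
noncomputable def UnitarilyInvariantNorm.kyFan (k : ℕ) (hk : k ≠ 0) :
    UnitarilyInvariantNorm H where
  ideal := ⊤
  mul_mem_left _ _ _ := trivial
  mul_mem_right _ _ _ := trivial
  val := kyFanNorm k
  val_add_le X _ Y _ := kyFanNorm_add_le k X Y
  val_smul c X _ := kyFanNorm_smul k c X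
  eq_zero_of_val_eq_zero X _ h := eq_zero_of_kyFanNorm_eq_zero hk h
  val_unitary_mul_mul U hU V hV X _ := by
    refine le_antisymm (kyFanNorm_unitary_le k hU hV X) ?_
    have h := kyFanNorm_unitary_le k (Unitary.star_mem hU) (Unitary.star_mem hV) (U * X * V)
    have e : star U * (U * X * V) * star V = X := by
      rw [show star U * (U * X * V) * star V = star U * U * X * (V * star V) by noncomm_ring,
        Unitary.star_mul_self_of_mem hU, Unitary.mul_star_self_of_mem hV, one_mul, mul_one]
    rwa [e] at h

end KyFan

/-! ### Convexity of the Heinz norm function. -/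

section Heinz

open Set

variable {H : Type*} [NormedAddCommGroup H] [InnerProductSpace ℂ H] [CompleteSpace H]

/-- For nonnegative exponents `x^r` is continuous at `0` and the exponent law holds there, so `A`
need not be invertible. -/
theorem rpow_add_of_nonneg_exponents (A : H →L[ℂ] H) {s t : ℝ} (hs : 0 ≤ s) (ht : 0 ≤ t) :
    A ^ (s + t) = A ^ s * A ^ t := by
  have hc : ∀ r : ℝ, 0 ≤ r → Continuous fun x : NNReal => x ^ r := fun r hr =>
    NNReal.continuous_rpow_const hr
  simp only [CFC.rpow_def]
  rw [← cfc_mul _ _ A (hc s hs).continuousOn (hc t ht).continuousOn]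
  exact congrArg (fun f : NNReal → NNReal => cfc f A)
    (funext fun x => NNReal.rpow_add_of_nonneg x hs ht)

/-- On the spectrum `x^ν ≤ 1 + x`, uniformly in `ν`. The factor `‖1‖` covers the zero space. -/
theorem norm_rpow_le {A : H →L[ℂ] H} (hA : 0 ≤ A) {ν : ℝ} (hν : ν ∈ Icc (0 : ℝ) 1) :
    ‖A ^ ν‖ ≤ 1 + ‖A‖ * ‖(1 : H →L[ℂ] H)‖ := by
  rw [CFC.rpow_eq_cfc_real hA]
  refine norm_cfc_le (by positivity) fun x hx => ?_
  have hx0 : 0 ≤ x := spectrum_nonneg_of_nonneg hA hx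
  have hx1 : x ≤ ‖A‖ * ‖(1 : H →L[ℂ] H)‖ := by
    have := spectrum.norm_le_norm_mul_of_mem hx
    rwa [Real.norm_of_nonneg hx0] at this
  rw [Real.norm_of_nonneg (Real.rpow_nonneg hx0 _)]
  rcases le_total x 1 with h | h
  · have := Real.rpow_le_one hx0 h hν.1
    linarith
  · have := Real.rpow_le_rpow_of_exponent_le h hν.2
    rw [Real.rpow_one] at this
    linarith

variable {A B X : H →L[ℂ] H}

theorem heinzSum_symm (A B X : H →L[ℂ] H) (ν : ℝ) :
    heinzSum A B X (1 - ν) = heinzSum A B X ν := by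
  simp only [heinzSum, sub_sub_cancel]
  exact add_comm _ _

theorem heinzSum_mem {N : UnitarilyInvariantNorm H} (hX : X ∈ N.ideal) (ν : ℝ) :
    heinzSum A B X ν ∈ N.ideal :=
  N.ideal.add_mem (N.mul_mem_right _ _ (N.mul_mem_left _ _ hX))
    (N.mul_mem_right _ _ (N.mul_mem_left _ _ hX))

/-- The mean inequality for `Z = A^(c-d) X B^(1-c-d) + A^(1-c-d) X B^(c-d)`, with `A^d` and `B^d` as
outer factors. The right side stays the norm of one sum, because Ky Fan dominance compares
operators. -/
theorem two_mul_heinzNorm_le {N : UnitarilyInvariantNorm H}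
    (hX : X ∈ N.ideal) {c d : ℝ} (hd : 0 ≤ d) (hdc : d ≤ c) (hcd : c + d ≤ 1) :
    2 * N.val (heinzSum A B X c)
      ≤ N.val (heinzSum A B X (c - d) + heinzSum A B X (c + d)) := by
  have h1 : 0 ≤ c - d := by linarith
  have h2 : 0 ≤ 1 - c - d := by linarith
  have hadd := fun (S : H →L[ℂ] H) {s t : ℝ} (hs : 0 ≤ s) (ht : 0 ≤ t) =>
    rpow_add_of_nonneg_exponents S hs ht
  have key := N.two_mul_val_mul_mul_le (P := A ^ d) (Q := B ^ d)
    (Z := A ^ (c - d) * X * B ^ (1 - c - d) + A ^ (1 - c - d) * X * B ^ (c - d))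
    CFC.rpow_nonneg CFC.rpow_nonneg
    (N.ideal.add_mem (N.mul_mem_right _ _ (N.mul_mem_left _ _ hX))
      (N.mul_mem_right _ _ (N.mul_mem_left _ _ hX)))
  have e1 : heinzSum A B X c = A ^ d * (A ^ (c - d) * X * B ^ (1 - c - d)
      + A ^ (1 - c - d) * X * B ^ (c - d)) * B ^ d := by
    rw [heinzSum]
    rw [show A ^ c = A ^ d * A ^ (c - d) by rw [← hadd A hd h1]; congr 1; ring,
      show A ^ (1 - c) = A ^ d * A ^ (1 - c - d) by rw [← hadd A hd h2]; congr 1; ring,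
      show B ^ c = B ^ (c - d) * B ^ d by rw [← hadd B h1 hd]; congr 1; ring,
      show B ^ (1 - c) = B ^ (1 - c - d) * B ^ d by rw [← hadd B h2 hd]; congr 1; ring]
    noncomm_ring
  have e2 : heinzSum A B X (c - d) + heinzSum A B X (c + d)
      = A ^ d * A ^ d * (A ^ (c - d) * X * B ^ (1 - c - d) + A ^ (1 - c - d) * X * B ^ (c - d))
        + (A ^ (c - d) * X * B ^ (1 - c - d) + A ^ (1 - c - d) * X * B ^ (c - d))
          * (B ^ d * B ^ d) := by
    rw [heinzSum, heinzSum]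
    rw [show A ^ (c + d) = A ^ d * A ^ d * A ^ (c - d) by
        rw [← hadd A hd hd, ← hadd A (by linarith) h1]; congr 1; ring,
      show A ^ (1 - (c - d)) = A ^ d * A ^ d * A ^ (1 - c - d) by
        rw [← hadd A hd hd, ← hadd A (by linarith) h2]; congr 1; ring,
      show B ^ (c + d) = B ^ (c - d) * (B ^ d * B ^ d) by
        rw [← hadd B hd hd, ← hadd B h1 (by linarith)]; congr 1; ring,
      show B ^ (1 - (c - d)) = B ^ (1 - c - d) * (B ^ d * B ^ d) by
        rw [← hadd B hd hd, ← hadd B h2 (by linarith)]; congr 1; ring,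
      show 1 - (c + d) = 1 - c - d by ring]
    noncomm_ring
  rwa [← e1, ← e2] at key

theorem two_mul_heinzNorm_midpoint_le {N : UnitarilyInvariantNorm H}
    (hX : X ∈ N.ideal) {s t : ℝ} (hs : s ∈ Icc (0 : ℝ) 1) (ht : t ∈ Icc (0 : ℝ) 1) :
    2 * N.val (heinzSum A B X ((s + t) / 2))
      ≤ N.val (heinzSum A B X s + heinzSum A B X t) := by
  rcases le_total s t with h | h
  · have := two_mul_heinzNorm_le (A := A) (B := B) hX (c := (s + t) / 2) (d := (t - s) / 2)
      (by linarith) (by linarith [hs.1]) (by linarith [ht.2])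
    rwa [show (s + t) / 2 - (t - s) / 2 = s by ring,
      show (s + t) / 2 + (t - s) / 2 = t by ring] at this
  · have := two_mul_heinzNorm_le (A := A) (B := B) hX (c := (s + t) / 2) (d := (s - t) / 2)
      (by linarith) (by linarith [ht.1]) (by linarith [hs.2])
    rwa [show (s + t) / 2 - (s - t) / 2 = t by ring,
      show (s + t) / 2 + (s - t) / 2 = s by ring, add_comm (heinzSum A B X t)] at this

/-- Supplies the upper bound that turns midpoint convexity into convexity, so continuity of `F` is
not needed. -/
theorem heinzNorm_bounded {N : UnitarilyInvariantNorm H} (hA : 0 ≤ A) (hB : 0 ≤ B)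
    (hX : X ∈ N.ideal) : ∃ M, ∀ ν ∈ Icc (0 : ℝ) 1, heinzNorm N A B X ν ≤ M := by
  set a := 1 + ‖A‖ * ‖(1 : H →L[ℂ] H)‖
  set b := 1 + ‖B‖ * ‖(1 : H →L[ℂ] H)‖
  have hX0 := N.val_nonneg hX
  have hterm : ∀ s ∈ Icc (0 : ℝ) 1, ∀ t ∈ Icc (0 : ℝ) 1,
      N.val (A ^ s * X * B ^ t) ≤ 2 * b * (2 * a * N.val X) := by
    intro s hs t ht
    have h1 := N.val_mul_right_le (B ^ t) (N.mul_mem_left (A ^ s) X hX)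
    have h2 := N.val_mul_left_le (A ^ s) hX
    have h3 := norm_rpow_le hA hs
    have h4 := norm_rpow_le hB ht
    have h5 := N.val_nonneg (N.mul_mem_left (A ^ s) X hX)
    refine h1.trans ?_
    gcongr
    exact h2.trans (by gcongr)
  refine ⟨2 * b * (2 * a * N.val X) + 2 * b * (2 * a * N.val X), fun ν hν => ?_⟩
  have hν' : 1 - ν ∈ Icc (0 : ℝ) 1 := ⟨by linarith [hν.2], by linarith [hν.1]⟩
  exact (N.val_add_le _ (N.mul_mem_right _ _ (N.mul_mem_left _ _ hX)) _
    (N.mul_mem_right _ _ (N.mul_mem_left _ _ hX))).trans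
    (add_le_add (hterm _ hν _ hν') (hterm _ hν' _ hν))

theorem convexOn_heinzNorm {N : UnitarilyInvariantNorm H} (hA : 0 ≤ A) (hB : 0 ≤ B)
    (hX : X ∈ N.ideal) : ConvexOn ℝ (Icc 0 1) (heinzNorm N A B X) := by
  obtain ⟨M, hM⟩ := heinzNorm_bounded hA hB hX
  refine convexOn_Icc_of_midpoint hM fun s hs t ht => ?_
  have h1 := two_mul_heinzNorm_midpoint_le (A := A) (B := B) hX hs ht
  have h2 := N.val_add_le _ (heinzSum_mem (A := A) (B := B) hX s) _
    (heinzSum_mem (A := A) (B := B) hX t)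
  unfold heinzNorm
  linarith

theorem two_mul_kyFanNorm_heinzSum_le (k : ℕ) {s t : ℝ} (hs : s ∈ Icc (0 : ℝ) 1)
    (ht : t ∈ Icc (0 : ℝ) 1) :
    kyFanNorm k ((2 : ℂ) • heinzSum A B X ((s + t) / 2))
      ≤ kyFanNorm k (heinzSum A B X s + heinzSum A B X t) := by
  rcases eq_or_ne k 0 with rfl | hk
  · simp [kyFanNorm_zero_left]
  · rw [kyFanNorm_smul, Complex.norm_ofNat]
    exact two_mul_heinzNorm_midpoint_le (N := .kyFan H k hk) trivial hs ht

/-- A convex function symmetric about `1/2` is largest at the ends of `[μ, 1 - μ]`. By dominance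
this bounds `F` when `X` may lie outside the ideal. -/
theorem kyFanNorm_heinzSum_le (hA : 0 ≤ A) (hB : 0 ≤ B) (k : ℕ) {μ ν : ℝ} (hμ : 0 ≤ μ)
    (hν : ν ∈ Icc μ (1 - μ)) :
    kyFanNorm k (heinzSum A B X ν) ≤ kyFanNorm k (heinzSum A B X μ) := by
  rcases eq_or_ne k 0 with rfl | hk
  · simp [kyFanNorm_zero_left]
  · have hle : μ ≤ 1 - μ := hν.1.trans hν.2
    have hc := convexOn_heinzNorm (N := .kyFan H k hk) (X := X) hA hB trivial
    have := hc.le_max_of_mem_Icc (x := μ) (y := 1 - μ) ⟨hμ, by linarith⟩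
      ⟨by linarith, by linarith⟩ hν
    simp only [heinzNorm, heinzSum_symm, max_self] at this
    exact this

theorem convexOn_heinzNorm_of_kyFanDominance {N : UnitarilyInvariantNorm H} (hA : 0 ≤ A)
    (hB : 0 ≤ B) {μ : ℝ} (hμ : 0 ≤ μ) (hN : N.KyFanDominance)
    (hT : ∀ ν ∈ Icc μ (1 - μ), heinzSum A B X ν ∈ N.ideal) :
    ConvexOn ℝ (Icc μ (1 - μ)) (heinzNorm N A B X) := by
  have hsub : ∀ ν ∈ Icc μ (1 - μ), ν ∈ Icc (0 : ℝ) 1 := fun ν h =>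
    ⟨hμ.trans h.1, by linarith [h.2]⟩
  refine convexOn_Icc_of_midpoint (M := heinzNorm N A B X μ) (fun ν hν => ?_)
    fun s hs t ht => ?_
  · exact hN _ (hT ν hν) _ (hT μ ⟨le_rfl, hν.1.trans hν.2⟩) fun k =>
      kyFanNorm_heinzSum_le hA hB k hμ hν
  · have hm : (s + t) / 2 ∈ Icc μ (1 - μ) :=
      ⟨by linarith [hs.1, ht.1], by linarith [hs.2, ht.2]⟩
    have h1 := hN _ (N.ideal.smul_mem (2 : ℂ) (hT _ hm)) _ (N.ideal.add_mem (hT s hs) (hT t ht))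
      fun k => two_mul_kyFanNorm_heinzSum_le k (hsub s hs) (hsub t ht)
    rw [N.val_smul _ _ (hT _ hm), Complex.norm_ofNat] at h1
    have h2 := N.val_add_le _ (hT s hs) _ (hT t ht)
    unfold heinzNorm
    linarith

/-- Membership of `A^(1/2) X B^(1/2)` is recovered from `T(1/2)`, its double. -/
theorem heinzNorm_half {N : UnitarilyInvariantNorm H} (h : heinzSum A B X (1 / 2) ∈ N.ideal) :
    heinzNorm N A B X (1 / 2) = 2 * N.val (A ^ (1 / 2 : ℝ) * X * B ^ (1 / 2 : ℝ)) := by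
  have e : heinzSum A B X (1 / 2) = (2 : ℂ) • (A ^ (1 / 2 : ℝ) * X * B ^ (1 / 2 : ℝ)) := by
    rw [heinzSum, show (1 : ℝ) - 1 / 2 = 1 / 2 by norm_num, two_smul]
  have hm : A ^ (1 / 2 : ℝ) * X * B ^ (1 / 2 : ℝ) ∈ N.ideal := by
    have := N.ideal.smul_mem (2 : ℂ)⁻¹ h
    rwa [e, smul_smul, inv_mul_cancel₀ two_ne_zero, one_smul] at this
  rw [heinzNorm, e, N.val_smul _ _ hm, Complex.norm_ofNat]

theorem heinz_hermite_hadamard {N : UnitarilyInvariantNorm H} (hA : 0 ≤ A) (hB : 0 ≤ B) {μ : ℝ}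
    (hμ : μ ∈ Icc (0 : ℝ) (1 / 2))
    (hX : X ∈ N.ideal ∨
      (N.KyFanDominance ∧ ∀ ν ∈ Icc μ (1 - μ), heinzSum A B X ν ∈ N.ideal)) :
    2 * N.val (A ^ (1 / 2 : ℝ) * X * B ^ (1 / 2 : ℝ)) =
        dyadicMidpoint (heinzNorm N A B X) μ (1 - μ) 0 ∧
    Monotone (dyadicMidpoint (heinzNorm N A B X) μ (1 - μ)) ∧
    IntervalIntegrable (heinzNorm N A B X) MeasureTheory.volume μ (1 - μ) ∧
    (∀ n, dyadicMidpoint (heinzNorm N A B X) μ (1 - μ) n ≤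
      integralMean (heinzNorm N A B X) μ (1 - μ)) ∧
    (∀ n, integralMean (heinzNorm N A B X) μ (1 - μ) ≤
      dyadicTrapezoid (heinzNorm N A B X) μ (1 - μ) n) ∧
    Antitone (dyadicTrapezoid (heinzNorm N A B X) μ (1 - μ)) ∧
    dyadicTrapezoid (heinzNorm N A B X) μ (1 - μ) 0 = heinzNorm N A B X μ ∧
    Filter.Tendsto (dyadicMidpoint (heinzNorm N A B X) μ (1 - μ)) Filter.atTop
      (nhds (integralMean (heinzNorm N A B X) μ (1 - μ))) ∧
    Filter.Tendsto (dyadicTrapezoid (heinzNorm N A B X) μ (1 - μ)) Filter.atTop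
      (nhds (integralMean (heinzNorm N A B X) μ (1 - μ))) := by
  have hle : μ ≤ 1 - μ := by linarith [hμ.2]
  have hmem : heinzSum A B X (1 / 2) ∈ N.ideal := by
    rcases hX with hX | ⟨-, hT⟩
    · exact heinzSum_mem hX _
    · exact hT _ ⟨hμ.2, by linarith [hμ.2]⟩
  have hF : ConvexOn ℝ (Icc μ (1 - μ)) (heinzNorm N A B X) := by
    rcases hX with hX | ⟨hN, hT⟩
    · exact (convexOn_heinzNorm hA hB hX).subset
        (Icc_subset_Icc hμ.1 (by linarith [hμ.1])) (convex_Icc _ _)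
    · exact convexOn_heinzNorm_of_kyFanDominance hA hB hμ.1 hN hT
  have hbounds := fun n => hF.dyadic_bounds n hle
  refine ⟨?_, monotone_nat_of_le_succ fun n => (hbounds n).1, hF.intervalIntegrable_Icc hle,
    fun n => (hbounds n).2.1, fun n => (hbounds n).2.2.1,
    antitone_nat_of_succ_le fun n => (hbounds n).2.2.2, ?_,
    (hF.tendsto_dyadicTrapezoid hle).2, (hF.tendsto_dyadicTrapezoid hle).1⟩
  · rw [dyadicMidpoint_zero, show (μ + (1 - μ)) / 2 = 1 / 2 by ring, heinzNorm_half hmem]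
  · rw [dyadicTrapezoid_zero]
    simp only [heinzNorm, heinzSum_symm]
    ring

end Heinz

theorem theorem3p3 {H : Type*} [NormedAddCommGroup H] [InnerProductSpace ℂ H] [CompleteSpace H]
    [TopologicalSpace.SeparableSpace H]
    (A B X : H →L[ℂ] H) (hA : A.IsPositive) (hB : B.IsPositive)
    (N : UnitarilyInvariantNorm H) (μ : ℝ)
    (hX : X ∈ N.ideal ∨
      (N.KyFanDominance ∧ ∀ ν ∈ Set.uIcc μ (1 - μ), heinzSum A B X ν ∈ N.ideal)) :
    (μ ∈ Set.Icc (0 : ℝ) (1 / 2) →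
      2 * N.val (A ^ (1 / 2 : ℝ) * X * B ^ (1 / 2 : ℝ)) =
          dyadicMidpoint (heinzNorm N A B X) μ (1 - μ) 0 ∧
      Monotone (dyadicMidpoint (heinzNorm N A B X) μ (1 - μ)) ∧
      IntervalIntegrable (heinzNorm N A B X) MeasureTheory.volume μ (1 - μ) ∧
      (∀ n, dyadicMidpoint (heinzNorm N A B X) μ (1 - μ) n ≤
        integralMean (heinzNorm N A B X) μ (1 - μ)) ∧
      (∀ n, integralMean (heinzNorm N A B X) μ (1 - μ) ≤
        dyadicTrapezoid (heinzNorm N A B X) μ (1 - μ) n) ∧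
      Antitone (dyadicTrapezoid (heinzNorm N A B X) μ (1 - μ)) ∧
      dyadicTrapezoid (heinzNorm N A B X) μ (1 - μ) 0 = heinzNorm N A B X μ ∧
      Filter.Tendsto (dyadicMidpoint (heinzNorm N A B X) μ (1 - μ)) Filter.atTop
        (nhds (integralMean (heinzNorm N A B X) μ (1 - μ))) ∧
      Filter.Tendsto (dyadicTrapezoid (heinzNorm N A B X) μ (1 - μ)) Filter.atTop
        (nhds (integralMean (heinzNorm N A B X) μ (1 - μ)))) ∧
    (μ ∈ Set.Icc (1 / 2 : ℝ) 1 →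
      2 * N.val (A ^ (1 / 2 : ℝ) * X * B ^ (1 / 2 : ℝ)) =
          dyadicMidpoint (heinzNorm N A B X) (1 - μ) μ 0 ∧
      Monotone (dyadicMidpoint (heinzNorm N A B X) (1 - μ) μ) ∧
      IntervalIntegrable (heinzNorm N A B X) MeasureTheory.volume (1 - μ) μ ∧
      (∀ n, dyadicMidpoint (heinzNorm N A B X) (1 - μ) μ n ≤
        integralMean (heinzNorm N A B X) (1 - μ) μ) ∧
      (∀ n, integralMean (heinzNorm N A B X) (1 - μ) μ ≤
        dyadicTrapezoid (heinzNorm N A B X) (1 - μ) μ n) ∧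
      Antitone (dyadicTrapezoid (heinzNorm N A B X) (1 - μ) μ) ∧
      dyadicTrapezoid (heinzNorm N A B X) (1 - μ) μ 0 = heinzNorm N A B X μ ∧
      Filter.Tendsto (dyadicMidpoint (heinzNorm N A B X) (1 - μ) μ) Filter.atTop
        (nhds (integralMean (heinzNorm N A B X) (1 - μ) μ)) ∧
      Filter.Tendsto (dyadicTrapezoid (heinzNorm N A B X) (1 - μ) μ) Filter.atTop
        (nhds (integralMean (heinzNorm N A B X) (1 - μ) μ))) := by
  have hA' := A.nonneg_iff_isPositive.2 hA
  have hB' := B.nonneg_iff_isPositive.2 hB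
  constructor
  · intro hμ
    rw [Set.uIcc_of_le (by linarith [hμ.2])] at hX
    exact heinz_hermite_hadamard hA' hB' hμ hX
  · intro hμ
    rw [Set.uIcc_of_ge (by linarith [hμ.1])] at hX
    -- The case `μ ≥ 1/2` is the first case at `1 - μ`, with `F (1 - μ) = F μ`.
    have h := heinz_hermite_hadamard (μ := 1 - μ) hA' hB'
      ⟨by linarith [hμ.2], by linarith [hμ.1]⟩ (by rwa [sub_sub_cancel])
    have e : heinzNorm N A B X (1 - μ) = heinzNorm N A B X μ := by
      rw [heinzNorm, heinzSum_symm, heinzNorm]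
    rwa [sub_sub_cancel, e] at h
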